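/- **Setting.** Let $X_1,X_2,X_3$ be discrete random variables, in this order, where $X_i$ has state space $[d_i]=\{1,\dots,d_i\}$ with $d_i\ge 2$. For $A\subseteq[3]$ put $\mathcal R_A=\prod_{i\in A}[d_i]$. Let $\mathcal T$ be the rooted tree with nodes $x_1\cdots x_j\in\mathcal R_{[j]}$, $0\le j\le 3$ (the root is $j=0$), and edges $x_1\cdots x_{k-1}\to x_1\cdots x_k$; $L_j$ is the set of nodes with $j$ entries, and $E(v)$ is the set of edges leaving the node $v$. Let $\theta$ be a labeling of the edges by a finite set, such that for every inner node $v$ the labels of the edges in $E(v)$ are distinct, and for any two inner nodes $v,w$ the sets $\theta(E(v)),\theta(E(w))$ are equal or disjoint; $v,w$ are *in the same stage* if these sets are equal. $\mathcal T$ is a *CStree* if (1) nodes in different levels are in different stages; (2) $\theta(v\to vs)=\theta(w\to ws)$ for all $s\in[d_k]$ whenever $v,w\in L_{k-1}$ are in the same stage; (3) every stage $S\subseteq L_{k-1}$ has the form $\{v\in L_{k-1}: v_C=\mathbf x_C\}$ for some $C\subseteq[k-1]$ and $\mathbf x_C\in\mathcal R_C$. *Balanced.* For a node $v=x_1\cdots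 x_{j}$ let $t(v)=\sum_{\mathbf z\in\mathcal R_{[3]\setminus[j]}}\prod_{e\in E(v\to v\mathbf z)}\theta(e)$, a polynomial over $\mathbb R$ with the labels as indeterminates, where $E(v\to v\mathbf z)$ is the set of edges on the path from $v$ to the leaf $v\mathbf z$. $\mathcal T$ is *balanced* if $t(vs)\,t(wr)=t(vr)\,t(ws)$ for all $k\in[3]$, all $v,w\in L_{k-1}$ in the same stage and all $s,r\in[d_k]$. The model of a balanced CStree is called a *decomposable CSmodel*. *Minimal context DAGs.* Let $\mathcal J(\mathcal T)$ be the smallest set of formal context-specific independence statements $X_A\perp X_B\mid X_S,\,X_C=\mathbf x_C$ (with $A,B,S,C\subseteq[3]$ pairwise disjoint, $\mathbf x_C\in\mathcal R_C$) that contains, for each stage $Q\subseteq L_{k-1}$, the statement $X_k\perp X_{[k-1]\setminus C}\mid X_C=\mathbf x_C$, where $C$ is the set of all indices at which all elements of $Q$ agree and $\mathbf x_C$ is their common value, and that is closed under symmetry, decomposition, weak union, contraction, intersection (each in a fixed context), specialization (from $X_A\perp X_B\mid X_S,X_C=\mathbf x_C$ and $T\subseteq S$ deduce $X_A\perp X_B\mid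 X_{S\setminus T},X_{T\cup C}=\mathbf x_{T\cup C}$ for every $\mathbf x_T\in\mathcal R_T$) and absorption (if $T\subseteq C$ and $X_A\perp X_B\mid X_S,X_{C\setminus T}=\mathbf x_{C\setminus T},X_T=\mathbf x_T$ for all $\mathbf x_T\in\mathcal R_T$, deduce $X_A\perp X_B\mid X_{S\cup T},X_{C\setminus T}=\mathbf x_{C\setminus T}$). A context $X_C=\mathbf x_C$ is *minimal* if there is a statement $X_A\perp X_B\mid X_S,X_C=\mathbf x_C$ in $\mathcal J(\mathcal T)$ with $A,B\neq\emptyset$ such that for no non-empty $T\subseteq C$ the statement $X_A\perp X_B\mid X_{S\cup T},X_{C\setminus T}=\mathbf x_{C\setminus T}$ is in $\mathcal J(\mathcal T)$. A *minimal context DAG* for such a context is a directed graph $G$ with vertex set $[3]\setminus C$ and with $i<j$ for every edge $i\to j$, which is a minimal I-MAP of $\{X_A\perp X_B\mid X_S:\ X_A\perp X_B\mid X_S,X_C=\mathbf x_C\in\mathcal J(\mathcal T)\}$: every $d$-separation statement of $G$ (with $A,B\ne\emptyset$) is in this set, and this fails after removing any single edge of $G$. A DAG is *perfect* if any two distinct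 parents of a common vertex are adjacent. **Theorem.** A CStree $\mathcal T$ on $p=3$ variables is balanced, i.e. its model is a decomposable CSmodel, if and only if all minimal context DAGs of $\mathcal T$ are perfect. -/

import Mathlib

open Finset

/-- The state space `R_A = ∏_{i ∈ A} [d_i]` of the subvector `X_A` of `(X_i)_{i : Fin p}`. -/
abbrev Outcome {p : ℕ} (d : Fin p → ℕ) (A : Finset (Fin p)) : Type :=
  (i : A) → Fin (d i)

/-- The subvector `x_A` of `x_B`, for `A ⊆ B`. -/
def Outcome.sub {p : ℕ} {d : Fin p → ℕ} {A B : Finset (Fin p)} (h : A ⊆ B)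
    (x : Outcome d B) : Outcome d A :=
  fun i => x ⟨i.1, h i.2⟩

/-- The child `v s` of a node `v`, where `v` assigns values to the variables before `k`
and `s` is an outcome of the variable `k`. -/
def Outcome.child {p : ℕ} {d : Fin p → ℕ} {k : Fin p} (v : Outcome d (Iio k)) (s : Fin (d k)) :
    Outcome d (Iic k) :=
  fun i =>
    if h : i.1 = k then Fin.cast (by rw [h]) s
    else v ⟨i.1, Finset.mem_Iio.2 (lt_of_le_of_ne (Finset.mem_Iic.1 i.2) h)⟩

/-- A staged tree for the variables `X_0, …, X_{p-1}` in this order. The inner nodes preceding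
the variable `k` are the outcomes `v` of the variables before `k` (the root being the
empty outcome); the edges leaving `v` are indexed by the outcomes `s` of `X_k`, and
`label k v s` is the label of the edge `v → v s`. -/
structure StagedTree {p : ℕ} (d : Fin p → ℕ) (L : Type*) where
  label : (k : Fin p) → Outcome d (Iio k) → Fin (d k) → L
  label_injective : ∀ k v, Function.Injective (label k v)
  eq_or_disjoint : ∀ k v l w,
    Set.range (label k v) = Set.range (label l w) ∨
      Disjoint (Set.range (label k v)) (Set.range (label l w))

namespace StagedTree

variable {p : ℕ} {d : Fin p → ℕ} {L : Type*}

/-- Two inner nodes are in the same stage if the label sets of their outgoing edges agree. -/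
def SameStage (T : StagedTree d L) (k : Fin p) (v : Outcome d (Iio k))
    (l : Fin p) (w : Outcome d (Iio l)) : Prop :=
  Set.range (T.label k v) = Set.range (T.label l w)

/-- CStrees: nodes in different levels are in different stages; equal labels inside a stage
point to equal outcomes; every stage consists of all nodes of its level that agree with
some context `X_C = x_C`. -/
structure IsCStree (T : StagedTree d L) : Prop where
  level : ∀ k v l w, k ≠ l → ¬ T.SameStage k v l w
  compatible : ∀ k v w, T.SameStage k v k w → ∀ s, T.label k v s = T.label k w s
  context : ∀ k v, ∃ (C : Finset (Fin p)) (hC : C ⊆ Iio k) (x : Outcome d C),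
    ∀ w, T.SameStage k v k w ↔ w.sub hC = x

/-- The interpolating polynomial `t(v)` of a node `v` that assigns values to an initial
segment `A` of the variables: the sum, over all full outcomes `x` that extend `v`, of the product
of the labels along the path from `v` to the leaf `x`. -/
noncomputable def interp (T : StagedTree d L) {A : Finset (Fin p)} (v : Outcome d A) :
    MvPolynomial L ℝ :=
  ∑ x : (i : Fin p) → Fin (d i) with (∀ i : A, x i = v i),
    ∏ k ∈ Aᶜ, MvPolynomial.X (T.label k (fun i => x i) (x k))

/-- Every pair of nodes in the same stage is balanced. For a CStree `T` this says that
the model of `T` is a decomposable CSmodel. -/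
def IsBalanced (T : StagedTree d L) : Prop :=
  ∀ (k : Fin p) (v w : Outcome d (Iio k)), T.SameStage k v k w → ∀ s r : Fin (d k),
    T.interp (v.child s) * T.interp (w.child r) = T.interp (v.child r) * T.interp (w.child s)

/-- `T.Implied A B S C x` says that the statement `X_A ⊥ X_B | X_S, X_C = x` belongs to `J(T)`,
the closure under the context-specific independence axioms of the statements
`X_k ⊥ X_{[k-1] ∖ C} | X_C = x_C` given by the stages of `T`; here `C` is the set of all indices
at which all elements of the stage agree, and `x_C` is their common outcome.
The sets `A`, `B`, `S`, `C` of a derived statement are always pairwise disjoint. -/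
inductive Implied (T : StagedTree d L) :
    (A B S C : Finset (Fin p)) → Outcome d C → Prop
  | stage (k : Fin p) (v : Outcome d (Iio k)) (C : Finset (Fin p)) (hC : C ⊆ Iio k)
      (h : ∀ l : Iio k, l.1 ∈ C ↔ ∀ w, T.SameStage k v k w → w l = v l) :
      Implied T {k} (Iio k \ C) ∅ C (v.sub hC)
  | symmetry {A B S C : Finset (Fin p)} {x : Outcome d C} :
      Implied T A B S C x → Implied T B A S C x
  | decomposition {A B D S C : Finset (Fin p)} {x : Outcome d C} :
      Implied T A (B ∪ D) S C x → Implied T A B S C x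
  | weak_union {A B D S C : Finset (Fin p)} {x : Outcome d C} :
      Disjoint B D → Implied T A (B ∪ D) S C x → Implied T A B (S ∪ D) C x
  | contraction {A B D S C : Finset (Fin p)} {x : Outcome d C} :
      Implied T A B (S ∪ D) C x → Implied T A D S C x → Implied T A (B ∪ D) S C x
  | intersection {A B D S C : Finset (Fin p)} {x : Outcome d C} :
      Implied T A B (S ∪ D) C x → Implied T A S (B ∪ D) C x → Implied T A (B ∪ S) D C x
  | specialization {A B S C T' : Finset (Fin p)} (hT : T' ⊆ S) (y : Outcome d (T' ∪ C)) :
      Implied T A B S C (y.sub subset_union_right) → Implied T A B (S \ T') (T' ∪ C) y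
  | absorption {A B S C T' : Finset (Fin p)} (hT : T' ⊆ C) (x : Outcome d C) :
      Implied T A B S C x →
      (∀ y : Outcome d C, (∀ i : C, i.1 ∉ T' → y i = x i) → Implied T A B S C y) →
      Implied T A B (S ∪ T') (C \ T') (x.sub sdiff_subset)

/-- `X_C = x` is a minimal context: some (non-trivial) statement of `J(T)` has this context, and
no non-empty part of the context can be moved to the conditioning variables of that statement. -/
def IsMinimalContext (T : StagedTree d L) (C : Finset (Fin p)) (x : Outcome d C) : Prop :=
  ∃ A B S : Finset (Fin p), A.Nonempty ∧ B.Nonempty ∧ T.Implied A B S C x ∧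
    ∀ T' ⊆ C, T'.Nonempty → ¬ T.Implied A B (S ∪ T') (C \ T') (x.sub sdiff_subset)

end StagedTree

/-- A directed graph with vertex set `V` all of whose edges agree with the ordering of the
variables; in particular it is acyclic. -/
structure OrderedDAG {p : ℕ} (V : Finset (Fin p)) where
  Edge : Fin p → Fin p → Prop
  left_mem : ∀ {i j}, Edge i j → i ∈ V
  right_mem : ∀ {i j}, Edge i j → j ∈ V
  lt : ∀ {i j}, Edge i j → i < j

namespace OrderedDAG

variable {p : ℕ} {V : Finset (Fin p)}

/-- The parents of every vertex are pairwise adjacent. -/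
def IsPerfect (G : OrderedDAG V) : Prop :=
  ∀ i j k, G.Edge i k → G.Edge j k → i ≠ j → G.Edge i j ∨ G.Edge j i

/-- Removal of the edge `a → b`. -/
def removeEdge (G : OrderedDAG V) (a b : Fin p) : OrderedDAG V where
  Edge i j := G.Edge i j ∧ ¬ (i = a ∧ j = b)
  left_mem h := G.left_mem h.1
  right_mem h := G.right_mem h.1
  lt h := G.lt h.1

/-- `l` lists the vertices of a trail (a path in the skeleton) that is active given `S`: every
collider on it is in `S` or has a descendant in `S`, and no other inner vertex is in `S`. -/
structure IsActiveTrail (G : OrderedDAG V) (S : Finset (Fin p)) (l : List (Fin p)) : Prop where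
  nodup : l.Nodup
  adjacent : ∀ u v, [u, v] <:+: l → G.Edge u v ∨ G.Edge v u
  collider : ∀ u v w, [u, v, w] <:+: l → G.Edge u v → G.Edge w v →
    ∃ s ∈ S, Relation.ReflTransGen G.Edge v s
  noncollider : ∀ u v w, [u, v, w] <:+: l → ¬ (G.Edge u v ∧ G.Edge w v) → v ∉ S

/-- `A` and `B` are d-separated by `S`: no trail between them is active given `S`. -/
def DSep (G : OrderedDAG V) (A B S : Finset (Fin p)) : Prop :=
  ∀ a ∈ A, ∀ b ∈ B, ∀ l : List (Fin p),
    l.head? = some a → l.getLast? = some b → ¬ G.IsActiveTrail S l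

/-- `G` is an I-MAP for a set of conditional independence statements `X_A ⊥ X_B | X_S`
(with `A`, `B` non-empty): every d-separation statement of `G` is in the set. -/
def IsIMAP (G : OrderedDAG V) (J : Finset (Fin p) → Finset (Fin p) → Finset (Fin p) → Prop) :
    Prop :=
  ∀ A B S : Finset (Fin p), A ⊆ V → B ⊆ V → S ⊆ V → A.Nonempty → B.Nonempty →
    Disjoint A B → Disjoint A S → Disjoint B S → G.DSep A B S → J A B S

/-- An I-MAP such that the removal of any single edge renders it not an I-MAP. -/
def IsMinimalIMAP (G : OrderedDAG V)
    (J : Finset (Fin p) → Finset (Fin p) → Finset (Fin p) → Prop) : Prop :=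
  G.IsIMAP J ∧ ∀ a b, G.Edge a b → ¬ (G.removeEdge a b).IsIMAP J

end OrderedDAG

/-- `G` is a minimal context DAG of `T` for the minimal context `X_C = x`: a minimal I-MAP, on the
variables outside `C`, of the statements `X_A ⊥ X_B | X_S` that hold in `J(T)` in this context. -/
def StagedTree.IsMinimalContextDAG {p : ℕ} {d : Fin p → ℕ} {L : Type*} (T : StagedTree d L)
    (C : Finset (Fin p)) (x : Outcome d C) (G : OrderedDAG Cᶜ) : Prop :=
  T.IsMinimalContext C x ∧ G.IsMinimalIMAP (fun A B S => T.Implied A B S C x)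

/-! Number the variables from 0. Both sides are equivalent to one condition on stages: if all nodes
before `X_1` share a stage, then the stages before `X_2` depend on `X_0` alone or on `X_1` alone.

Balancedness is automatic at the root and at the last level. Before `X_1` it has content only when
two distinct nodes share a stage, and then all do. In `t(vs) t(wr) = t(vr) t(ws)` each factor is the
sum of the labels of one stage; setting the labels at `vs` to zero shows that `vr` or `ws` lies in
the stage of `vs` (`sameStage_or_of_mul_eq`). A table of stages with this property has constant rows
or constant columns.

The only imperfect ordered DAG on at most three vertices is the collider `0 → 2 ← 1`, which forces
the empty context. It is a minimal I-MAP exactly when `J(T)` contains `X_0 ⊥ X_1` but neither `X_1 ⊥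
X_2 | X_0` nor `X_0 ⊥ X_2 | X_1`. These statements translate into stages:
`StageDeterminedBy.implied` derives them from the axioms, and `IsCStree.sameStage_of_implied` gives
the converse by soundness. The axioms hold for positive weights, and a uniform weight tilted at a
single stage satisfies all stage statements but refutes those that ignore this stage. -/

/-! ### Marginals of positive weights and soundness of the independence axioms -/

section Marginals

variable {p : ℕ} {d : Fin p → ℕ}

/-- The marginal weight of the subvector `y_U` under the weight `f` on the full outcomes. -/
def marginal (f : ((i : Fin p) → Fin (d i)) → ℝ) (U : Finset (Fin p))
    (y : (i : Fin p) → Fin (d i)) : ℝ :=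
  ∑ z with ∀ i ∈ U, z i = y i, f z

/-- The number of full outcomes that extend a given outcome of the variables in `U`. -/
def extensionCount (d : Fin p → ℕ) (U : Finset (Fin p)) : ℕ := ∏ i ∈ Uᶜ, d i

theorem card_extensions (U : Finset (Fin p)) (y : (i : Fin p) → Fin (d i)) :
    #{z : (i : Fin p) → Fin (d i) | ∀ i ∈ U, z i = y i} = extensionCount d U := by
  have h : ({z : (i : Fin p) → Fin (d i) | ∀ i ∈ U, z i = y i} : Finset _) =
      Fintype.piFinset fun i => if i ∈ U then {y i} else univ := by
    ext z
    simp only [mem_filter, mem_univ, true_and, Fintype.mem_piFinset]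
    refine forall_congr' fun i => ?_
    by_cases hi : i ∈ U <;> simp [hi]
  rw [h, Fintype.card_piFinset, extensionCount, ← Finset.prod_mul_prod_compl U]
  rw [Finset.prod_eq_one, one_mul]
  · refine Finset.prod_congr rfl fun i hi => ?_
    simp [Finset.mem_compl.1 hi]
  · intro i hi
    simp [hi]

theorem extensionCount_pos (hd : ∀ i, 2 ≤ d i) (U : Finset (Fin p)) :
    (0 : ℝ) < extensionCount d U :=
  Nat.cast_pos.2 (Finset.prod_pos fun i _ => lt_of_lt_of_le two_pos (hd i))

theorem marginal_congr (f : ((i : Fin p) → Fin (d i)) → ℝ) {U : Finset (Fin p)}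
    {y z : (i : Fin p) → Fin (d i)} (h : ∀ i ∈ U, y i = z i) : marginal f U y = marginal f U z := by
  unfold marginal
  congr 1
  ext w
  simp only [mem_filter, mem_univ, true_and]
  exact forall₂_congr fun i hi => by rw [h i hi]

theorem marginal_pos {f : ((i : Fin p) → Fin (d i)) → ℝ} (hf : ∀ z, 0 < f z)
    (U : Finset (Fin p)) (y : (i : Fin p) → Fin (d i)) : 0 < marginal f U y :=
  Finset.sum_pos (fun z _ => hf z) ⟨y, by simp⟩

theorem marginal_eq_of_forall {f : ((i : Fin p) → Fin (d i)) → ℝ} {U : Finset (Fin p)}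
    {y : (i : Fin p) → Fin (d i)} {c : ℝ} (h : ∀ z, (∀ i ∈ U, z i = y i) → f z = c) :
    marginal f U y = extensionCount d U * c := by
  unfold marginal
  rw [Finset.sum_congr rfl fun z hz => h z (by simpa using hz), Finset.sum_const, card_extensions,
    nsmul_eq_mul]

/-- Double counting: each `z` that agrees with `y` on `U ∩ V` is counted once for every `w`
extending the gluing of `y_U` and `z_V`. Summing over full outcomes `w` avoids partial outcomes, at
the price of the constant factor. -/
theorem sum_marginal (f : ((i : Fin p) → Fin (d i)) → ℝ) (U V : Finset (Fin p))
    (y : (i : Fin p) → Fin (d i)) :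
    ∑ w with ∀ i ∈ U, w i = y i, marginal f V w =
      extensionCount d (U ∪ V) * marginal f (U ∩ V) y := by
  unfold marginal
  rw [Finset.sum_comm' (s' := fun z => ({w : (i : Fin p) → Fin (d i) |
    (∀ i ∈ U, w i = y i) ∧ ∀ i ∈ V, w i = z i} : Finset _))
    (t' := ({z : (i : Fin p) → Fin (d i) | ∀ i ∈ U ∩ V, z i = y i} : Finset _))]
  · rw [Finset.mul_sum]
    refine Finset.sum_congr rfl fun z hz => ?_
    simp only [mem_filter, mem_univ, true_and, mem_inter] at hz
    rw [Finset.sum_const, nsmul_eq_mul]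
    congr 2
    rw [← card_extensions (U ∪ V) (fun i => if i ∈ U then y i else z i)]
    congr 1
    ext w
    simp only [mem_filter, mem_univ, true_and, mem_union]
    constructor
    · rintro ⟨h1, h2⟩ i hi
      by_cases hU : i ∈ U
      · simp [hU, h1 i hU]
      · simp [hU, h2 i (hi.resolve_left hU)]
    · intro h
      refine ⟨fun i hi => by simpa [hi] using h i (Or.inl hi), fun i hi => ?_⟩
      by_cases hU : i ∈ U
      · rw [hz i ⟨hU, hi⟩]
        simpa [hU] using h i (Or.inl hU)
      · simpa [hU] using h i (Or.inr hi)
  · intro w z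
    simp only [mem_filter, mem_univ, true_and, mem_inter]
    constructor
    · rintro ⟨h1, h2⟩
      exact ⟨⟨h1, fun i hi => (h2 i hi).symm⟩, fun i hi => (h2 i hi.2).trans (h1 i hi.1)⟩
    · rintro ⟨⟨h1, h2⟩, -⟩
      exact ⟨h1, fun i hi => (h2 i hi).symm⟩

/-- The context-specific independence `X_A ⊥ X_B | X_S, X_C = x` under the weight `f`. -/
structure CondIndep (f : ((i : Fin p) → Fin (d i)) → ℝ) (A B S C : Finset (Fin p))
    (x : Outcome d C) : Prop where
  disjoint : Disjoint A B
  disjoint_left : Disjoint A (S ∪ C)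
  disjoint_right : Disjoint B (S ∪ C)
  factor : ∀ y : (i : Fin p) → Fin (d i), (∀ i : C, y i = x i) →
    marginal f (A ∪ B ∪ (S ∪ C)) y * marginal f (S ∪ C) y =
      marginal f (A ∪ (S ∪ C)) y * marginal f (B ∪ (S ∪ C)) y

namespace CondIndep

variable {f : ((i : Fin p) → Fin (d i)) → ℝ} {A B D S C : Finset (Fin p)} {x : Outcome d C}

theorem symm (h : CondIndep f A B S C x) : CondIndep f B A S C x where
  disjoint := h.disjoint.symm
  disjoint_left := h.disjoint_right
  disjoint_right := h.disjoint_left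
  factor y hy := by rw [union_comm B A, h.factor y hy, mul_comm]

theorem decomposition (hd : ∀ i, 2 ≤ d i) (h : CondIndep f A (B ∪ D) S C x) :
    CondIndep f A B S C x where
  disjoint := h.disjoint.mono_right subset_union_left
  disjoint_left := h.disjoint_left
  disjoint_right := h.disjoint_right.mono_left subset_union_left
  factor y hy := by
    have h1 := sum_marginal f (A ∪ B ∪ (S ∪ C)) (A ∪ (B ∪ D) ∪ (S ∪ C)) y
    have h2 := sum_marginal f (A ∪ B ∪ (S ∪ C)) (B ∪ D ∪ (S ∪ C)) y
    have hAB := Finset.disjoint_left.1 h.disjoint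
    have hA := Finset.disjoint_left.1 h.disjoint_left
    have e1 : A ∪ B ∪ (S ∪ C) ∪ (A ∪ (B ∪ D) ∪ (S ∪ C)) = A ∪ B ∪ D ∪ S ∪ C := by
      ext; simp only [mem_union]; tauto
    have e2 : A ∪ B ∪ (S ∪ C) ∪ (B ∪ D ∪ (S ∪ C)) = A ∪ B ∪ D ∪ S ∪ C := by
      ext; simp only [mem_union]; tauto
    have e3 : (A ∪ B ∪ (S ∪ C)) ∩ (A ∪ (B ∪ D) ∪ (S ∪ C)) = A ∪ B ∪ (S ∪ C) := by
      ext; simp only [mem_union, mem_inter]; tauto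
    have e4 : (A ∪ B ∪ (S ∪ C)) ∩ (B ∪ D ∪ (S ∪ C)) = B ∪ (S ∪ C) := by
      ext i
      have := @hAB i
      have := @hA i
      simp only [mem_union, mem_inter] at *
      tauto
    rw [e1, e3] at h1
    rw [e2, e4] at h2
    -- The factorization is summed over the values of `D`. Both sums carry the same multiplicity,
    -- since `e1` and `e2` have the same right-hand side.
    have h3 : ∀ w ∈ ({w : (i : Fin p) → Fin (d i) | ∀ i ∈ A ∪ B ∪ (S ∪ C), w i = y i} : Finset _),
        marginal f (A ∪ (B ∪ D) ∪ (S ∪ C)) w * marginal f (S ∪ C) y =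
          marginal f (A ∪ (S ∪ C)) y * marginal f (B ∪ D ∪ (S ∪ C)) w := by
      intro w hw
      simp only [mem_filter, mem_univ, true_and] at hw
      rw [← marginal_congr f (y := w) (z := y) (U := S ∪ C)
          fun i hi => hw i (mem_union_right _ hi),
        ← marginal_congr f (y := w) (z := y) (U := A ∪ (S ∪ C))
          fun i hi => hw i (by simp only [mem_union] at *; tauto)]
      exact h.factor w fun i => (hw i (by simp)).trans (hy i)
    have h4 := Finset.sum_congr rfl h3
    rw [← Finset.sum_mul, ← Finset.mul_sum, h1, h2] at h4
    refine mul_left_cancel₀ (extensionCount_pos hd (A ∪ B ∪ D ∪ S ∪ C)).ne' ?_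
    linear_combination h4

theorem weak_union (hd : ∀ i, 2 ≤ d i) (hf : ∀ z, 0 < f z) (hBD : Disjoint B D)
    (h : CondIndep f A (B ∪ D) S C x) : CondIndep f A B (S ∪ D) C x where
  disjoint := h.disjoint.mono_right subset_union_left
  disjoint_left := by
    have := h.disjoint
    have := h.disjoint_left
    simp only [disjoint_union_right] at *
    tauto
  disjoint_right := by
    have := h.disjoint_right
    simp only [disjoint_union_right, disjoint_union_left] at *
    tauto
  factor y hy := by
    have h1 := h.factor y hy
    have h2 := (decomposition hd (B := D) (D := B) (by rwa [union_comm D B])).factor y hy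
    have e1 : A ∪ B ∪ (S ∪ D ∪ C) = A ∪ (B ∪ D) ∪ (S ∪ C) := by
      ext; simp only [mem_union]; tauto
    have e2 : S ∪ D ∪ C = D ∪ (S ∪ C) := by
      ext; simp only [mem_union]; tauto
    have e3 : A ∪ (D ∪ (S ∪ C)) = A ∪ D ∪ (S ∪ C) := (union_assoc _ _ _).symm
    have e4 : B ∪ (D ∪ (S ∪ C)) = B ∪ D ∪ (S ∪ C) := (union_assoc _ _ _).symm
    rw [e1, e2, e3, e4]
    refine mul_left_cancel₀ (marginal_pos hf (S ∪ C) y).ne' ?_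
    linear_combination marginal f (D ∪ (S ∪ C)) y * h1 - marginal f (B ∪ D ∪ (S ∪ C)) y * h2

theorem contraction (hf : ∀ z, 0 < f z) (h1 : CondIndep f A B (S ∪ D) C x)
    (h2 : CondIndep f A D S C x) : CondIndep f A (B ∪ D) S C x where
  disjoint := disjoint_union_right.2 ⟨h1.disjoint, h2.disjoint⟩
  disjoint_left := h2.disjoint_left
  disjoint_right := by
    have := h1.disjoint_right
    have := h2.disjoint_right
    simp only [disjoint_union_right, disjoint_union_left] at *
    tauto
  factor y hy := by
    have h3 := h1.factor y hy
    have h4 := h2.factor y hy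
    have e1 : A ∪ B ∪ (S ∪ D ∪ C) = A ∪ (B ∪ D) ∪ (S ∪ C) := by
      ext; simp only [mem_union]; tauto
    have e2 : S ∪ D ∪ C = D ∪ (S ∪ C) := by
      ext; simp only [mem_union]; tauto
    have e3 : A ∪ (D ∪ (S ∪ C)) = A ∪ D ∪ (S ∪ C) := (union_assoc _ _ _).symm
    have e4 : B ∪ (D ∪ (S ∪ C)) = B ∪ D ∪ (S ∪ C) := (union_assoc _ _ _).symm
    rw [e1, e2, e3, e4] at h3
    refine mul_left_cancel₀ (marginal_pos hf (D ∪ (S ∪ C)) y).ne' ?_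
    linear_combination marginal f (S ∪ C) y * h3 + marginal f (B ∪ D ∪ (S ∪ C)) y * h4

/-- By contraction it suffices to show `A ⊥ S | D`. Dividing the two factorizations, which needs
positivity, shows that the conditional weight of `A` given `S, D` equals that given `B, D`; summing
over `B` then removes `B`. -/
theorem intersection (hd : ∀ i, 2 ≤ d i) (hf : ∀ z, 0 < f z)
    (h1 : CondIndep f A B (S ∪ D) C x) (h2 : CondIndep f A S (B ∪ D) C x) :
    CondIndep f A (B ∪ S) D C x := by
  have h3 : CondIndep f A S D C x := by
    refine ⟨h2.disjoint, ?_, ?_, fun y hy => ?_⟩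
    · have := h1.disjoint_left
      simp only [disjoint_union_right] at *
      tauto
    · have := h2.disjoint_right
      simp only [disjoint_union_right] at *
      tauto
    have hAB := Finset.disjoint_left.1 h1.disjoint
    have hB := Finset.disjoint_left.1 h1.disjoint_right
    have s1 := sum_marginal f (A ∪ S ∪ (D ∪ C)) (B ∪ (D ∪ C)) y
    have s2 := sum_marginal f (A ∪ S ∪ (D ∪ C)) (A ∪ (B ∪ (D ∪ C))) y
    have e1 : A ∪ S ∪ (D ∪ C) ∪ (B ∪ (D ∪ C)) = A ∪ B ∪ S ∪ D ∪ C := by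
      ext; simp only [mem_union]; tauto
    have e2 : A ∪ S ∪ (D ∪ C) ∪ (A ∪ (B ∪ (D ∪ C))) = A ∪ B ∪ S ∪ D ∪ C := by
      ext; simp only [mem_union]; tauto
    have e3 : (A ∪ S ∪ (D ∪ C)) ∩ (B ∪ (D ∪ C)) = D ∪ C := by
      ext i
      have := @hAB i
      have := @hB i
      simp only [mem_union, mem_inter] at *
      tauto
    have e4 : (A ∪ S ∪ (D ∪ C)) ∩ (A ∪ (B ∪ (D ∪ C))) = A ∪ (D ∪ C) := by
      ext i
      have := @hAB i
      have := @hB i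
      simp only [mem_union, mem_inter] at *
      tauto
    rw [e1, e3] at s1
    rw [e2, e4] at s2
    have key : ∀ w ∈ ({w : (i : Fin p) → Fin (d i) | ∀ i ∈ A ∪ S ∪ (D ∪ C), w i = y i} : Finset _),
        marginal f (A ∪ S ∪ (D ∪ C)) y * marginal f (B ∪ (D ∪ C)) w =
          marginal f (S ∪ (D ∪ C)) y * marginal f (A ∪ (B ∪ (D ∪ C))) w := by
      intro w hw
      simp only [mem_filter, mem_univ, true_and] at hw
      rw [← marginal_congr f (y := w) (z := y) (U := A ∪ S ∪ (D ∪ C)) hw,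
        ← marginal_congr f (y := w) (z := y) (U := S ∪ (D ∪ C))
          fun i hi => hw i (by simp only [mem_union] at *; tauto)]
      have hC : ∀ i : C, w i = x i := fun i => (hw i (by simp)).trans (hy i)
      have t1 := h1.factor w hC
      have t2 := h2.factor w hC
      have g1 : A ∪ (S ∪ D ∪ C) = A ∪ S ∪ (D ∪ C) := by simp only [union_assoc]
      have g2 : S ∪ (B ∪ D ∪ C) = B ∪ (S ∪ D ∪ C) := by
        ext; simp only [mem_union]; tauto
      have g3 : A ∪ S ∪ (B ∪ D ∪ C) = A ∪ B ∪ (S ∪ D ∪ C) := by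
        ext; simp only [mem_union]; tauto
      have g4 : S ∪ D ∪ C = S ∪ (D ∪ C) := union_assoc _ _ _
      have g5 : B ∪ D ∪ C = B ∪ (D ∪ C) := union_assoc _ _ _
      rw [g1, g4] at t1
      rw [g2, g3, g4, g5] at t2
      refine mul_left_cancel₀ (marginal_pos hf (B ∪ (S ∪ (D ∪ C))) w).ne' ?_
      linear_combination marginal f (S ∪ (D ∪ C)) w * t2 - marginal f (B ∪ (D ∪ C)) w * t1
    have h4 := Finset.sum_congr rfl key
    rw [← Finset.mul_sum, ← Finset.mul_sum, s1, s2] at h4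
    refine mul_left_cancel₀ (extensionCount_pos hd (A ∪ B ∪ S ∪ D ∪ C)).ne' ?_
    linear_combination h4
  exact contraction hf (by rwa [union_comm D S]) h3

theorem specialization {T : Finset (Fin p)} (hT : T ⊆ S) (y : Outcome d (T ∪ C))
    (h : CondIndep f A B S C (y.sub subset_union_right)) :
    CondIndep f A B (S \ T) (T ∪ C) y := by
  have e : S \ T ∪ (T ∪ C) = S ∪ C := by rw [← union_assoc, sdiff_union_of_subset hT]
  refine ⟨h.disjoint, e ▸ h.disjoint_left, e ▸ h.disjoint_right, fun z hz => ?_⟩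
  rw [e]
  exact h.factor z fun i => hz ⟨i.1, _⟩

theorem absorption {T : Finset (Fin p)} (hT : T ⊆ C) (h : CondIndep f A B S C x)
    (hy : ∀ y : Outcome d C, (∀ i : C, i.1 ∉ T → y i = x i) → CondIndep f A B S C y) :
    CondIndep f A B (S ∪ T) (C \ T) (x.sub sdiff_subset) := by
  have e : S ∪ T ∪ C \ T = S ∪ C := by rw [union_assoc, union_sdiff_of_subset hT]
  refine ⟨h.disjoint, e ▸ h.disjoint_left, e ▸ h.disjoint_right, fun z hz => ?_⟩
  rw [e]
  exact (hy (fun i => z i) fun i hi => hz ⟨i.1, mem_sdiff.2 ⟨i.2, hi⟩⟩).factor z fun _ => rfl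

/-- If in the context `X_C = x` the conditional weight of `X_k` given the preceding variables is
a function of `X_k` alone, then `X_k` is independent of the preceding variables. -/
theorem of_chain_rule (hd : ∀ i, 2 ≤ d i) {k : Fin p} (hC : C ⊆ Iio k) (r : Fin (d k) → ℝ)
    (h : ∀ y : (i : Fin p) → Fin (d i), (∀ i : C, y i = x i) →
      marginal f (Iic k) y = r (y k) * marginal f (Iio k) y) :
    CondIndep f {k} (Iio k \ C) ∅ C x where
  disjoint := by simp
  disjoint_left := by
    rw [empty_union, disjoint_singleton_left]
    exact fun hk => lt_irrefl k (mem_Iio.1 (hC hk))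
  disjoint_right := by
    rw [empty_union]
    exact sdiff_disjoint
  factor y hy := by
    have e1 : {k} ∪ Iio k \ C ∪ (∅ ∪ C) = Iic k := by
      rw [empty_union, union_assoc, sdiff_union_of_subset hC, ← insert_eq, Finset.Iio_insert]
    have e2 : Iio k \ C ∪ (∅ ∪ C) = Iio k := by rw [empty_union, sdiff_union_of_subset hC]
    rw [e1, e2, empty_union]
    -- Summing the chain rule over the preceding variables outside `C`, with `X_k` fixed, expresses
    -- `r (y k)` through the marginals on `{k} ∪ C` and on `C`.
    have s1 := sum_marginal f ({k} ∪ C) (Iic k) y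
    have s2 := sum_marginal f ({k} ∪ C) (Iio k) y
    have e3 : {k} ∪ C ∪ Iic k = Iic k := by
      refine union_eq_right.2 (union_subset (by simp) (hC.trans fun i hi => ?_))
      exact mem_Iic.2 (mem_Iio.1 hi).le
    have e4 : {k} ∪ C ∪ Iio k = Iic k := by
      rw [union_assoc, union_eq_right.2 hC, ← insert_eq, Finset.Iio_insert]
    have e5 : ({k} ∪ C) ∩ Iic k = {k} ∪ C := inter_eq_left.2 (e3 ▸ subset_union_left)
    have e6 : ({k} ∪ C) ∩ Iio k = C := by
      rw [union_inter_distrib_right, inter_eq_left.2 hC]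
      simp
    rw [e3, e5] at s1
    rw [e4, e6] at s2
    have key : ∀ w ∈ ({w : (i : Fin p) → Fin (d i) | ∀ i ∈ {k} ∪ C, w i = y i} : Finset _),
        marginal f (Iic k) w = r (y k) * marginal f (Iio k) w := by
      intro w hw
      simp only [mem_filter, mem_univ, true_and] at hw
      rw [← hw k (by simp)]
      exact h w fun i => (hw i (by simp)).trans (hy i)
    have h4 := Finset.sum_congr rfl key
    rw [← Finset.mul_sum, s1, s2] at h4
    refine mul_left_cancel₀ (extensionCount_pos hd (Iic k)).ne' ?_
    rw [h y hy]
    linear_combination -marginal f (Iio k) y * h4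

end CondIndep

end Marginals

/-! ### Soundness of `J(T)` and weights that detect a single stage -/

namespace StagedTree

variable {p : ℕ} {d : Fin p → ℕ} {L : Type*}

theorem SameStage.symm {T : StagedTree d L} {k l : Fin p} {v : Outcome d (Iio k)}
    {w : Outcome d (Iio l)} (h : T.SameStage k v l w) : T.SameStage l w k v :=
  Eq.symm h

theorem SameStage.trans {T : StagedTree d L} {k l m : Fin p} {v : Outcome d (Iio k)}
    {w : Outcome d (Iio l)} {u : Outcome d (Iio m)} (h : T.SameStage k v l w)
    (h' : T.SameStage l w m u) : T.SameStage k v m u :=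
  Eq.trans h h'

/-- Every statement of `J(T)` holds under a positive weight under which the stage statements
hold. -/
theorem Implied.condIndep {T : StagedTree d L} (hd : ∀ i, 2 ≤ d i)
    {f : ((i : Fin p) → Fin (d i)) → ℝ} (hf : ∀ z, 0 < f z)
    (hstage : ∀ (k : Fin p) (v : Outcome d (Iio k)) (C : Finset (Fin p)) (hC : C ⊆ Iio k),
      (∀ l : Iio k, l.1 ∈ C ↔ ∀ w, T.SameStage k v k w → w l = v l) →
        CondIndep f {k} (Iio k \ C) ∅ C (v.sub hC))
    {A B S C : Finset (Fin p)} {x : Outcome d C} (h : T.Implied A B S C x) :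
    CondIndep f A B S C x := by
  induction h with
  | stage k v C hC h => exact hstage k v C hC h
  | symmetry _ ih => exact ih.symm
  | decomposition _ ih => exact ih.decomposition hd
  | weak_union hBD _ ih => exact ih.weak_union hd hf hBD
  | contraction _ _ ih₁ ih₂ => exact ih₁.contraction hf ih₂
  | intersection _ _ ih₁ ih₂ => exact ih₁.intersection hd hf ih₂
  | specialization hT y _ ih => exact ih.specialization hT
  | absorption hT x _ _ ih ih' => exact ih.absorption hT ih'

/-- All nodes that agree with `v` where all nodes of its stage agree belong to this stage. -/
theorem IsCStree.sameStage_of_agree {T : StagedTree d L} (hT : T.IsCStree) {k : Fin p}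
    {v w : Outcome d (Iio k)} {C : Finset (Fin p)}
    (hC : ∀ l : Iio k, l.1 ∈ C ↔ ∀ w, T.SameStage k v k w → w l = v l)
    (hw : ∀ l : Iio k, l.1 ∈ C → w l = v l) : T.SameStage k v k w := by
  obtain ⟨C', hC', x, h⟩ := hT.context k v
  have hv : v.sub hC' = x := (h v).1 rfl
  -- The defining context `C'` of the stage lies inside `C`, because all its nodes agree there.
  refine (h w).2 (hv ▸ funext fun i => hw ⟨i.1, hC' i.2⟩ ((hC _).2 fun u hu => ?_))
  exact congrFun (((h u).1 hu).trans hv.symm) i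

/-- A function on the outcomes of a variable that takes the values `1` and `-1` once and
vanishes elsewhere. -/
def tilt {n : ℕ} (s : Fin n) : ℝ := if s.1 = 0 then 1 else if s.1 = 1 then -1 else 0

theorem tilt_swap {n : ℕ} (hn : 2 ≤ n) (s : Fin n) :
    tilt (Equiv.swap (⟨0, by omega⟩ : Fin n) ⟨1, by omega⟩ s) = -tilt s := by
  unfold tilt
  rw [Equiv.swap_apply_def]
  rcases s with ⟨s, hs⟩
  simp only [Fin.mk.injEq]
  split_ifs <;> simp_all

open Classical in
/-- The weight that is uniform except that the conditional weights of `X_k` at the stage of `v`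
are perturbed. -/
noncomputable def tiltedWeight (T : StagedTree d L) (k : Fin p) (v : Outcome d (Iio k))
    (y : (i : Fin p) → Fin (d i)) : ℝ :=
  2 + (if T.SameStage k v k (fun i => y i) then 1 else 0) * tilt (y k)

theorem tiltedWeight_pos (T : StagedTree d L) (k : Fin p) (v : Outcome d (Iio k))
    (y : (i : Fin p) → Fin (d i)) : 0 < T.tiltedWeight k v y := by
  unfold tiltedWeight tilt
  split_ifs <;> norm_num

theorem tiltedWeight_congr (T : StagedTree d L) {k : Fin p} {v : Outcome d (Iio k)}
    {y z : (i : Fin p) → Fin (d i)}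
    (h : T.SameStage k v k (fun i => y i) ↔ T.SameStage k v k (fun i => z i)) (hk : y k = z k) :
    T.tiltedWeight k v y = T.tiltedWeight k v z := by
  classical
  unfold tiltedWeight
  rw [hk, if_congr h rfl rfl]

theorem marginal_tiltedWeight_of_Iic_subset (T : StagedTree d L) {k : Fin p}
    (v : Outcome d (Iio k)) {U : Finset (Fin p)} (hU : Iic k ⊆ U) (y : (i : Fin p) → Fin (d i)) :
    marginal (T.tiltedWeight k v) U y = extensionCount d U * T.tiltedWeight k v y := by
  refine marginal_eq_of_forall fun z hz => T.tiltedWeight_congr ?_ (hz k (hU (by simp)))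
  have : (fun i : Iio k => z i) = fun i : Iio k => y i :=
    funext fun i => hz i (hU (mem_Iic.2 (mem_Iio.1 i.2).le))
  rw [this]

/-- Swapping the outcomes 0 and 1 of `X_k` reverses the sign of the tilt and leaves the preceding
variables, hence the stage indicator, unchanged. The perturbation therefore cancels as soon as `X_k`
is summed out. -/
theorem marginal_tiltedWeight_of_notMem (T : StagedTree d L) (hd : ∀ i, 2 ≤ d i) {k : Fin p}
    (v : Outcome d (Iio k)) {U : Finset (Fin p)} (hU : k ∉ U) (y : (i : Fin p) → Fin (d i)) :
    marginal (T.tiltedWeight k v) U y = extensionCount d U * 2 := by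
  classical
  unfold marginal tiltedWeight
  rw [Finset.sum_add_distrib, Finset.sum_const, card_extensions, nsmul_eq_mul, add_eq_left]
  have hk := hd k
  have hres : ∀ (z : (i : Fin p) → Fin (d i)) (s : Fin (d k)),
      (fun i : Iio k => Function.update z k s i) = fun i : Iio k => z i := fun z s =>
    funext fun i => Function.update_of_ne (mem_Iio.1 i.2).ne _ _
  refine Finset.sum_involution
    (fun z _ => Function.update z k (Equiv.swap ⟨0, by omega⟩ ⟨1, by omega⟩ (z k))) ?_ ?_ ?_ ?_
  · intro z _
    rw [hres, Function.update_self, tilt_swap hk]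
    ring
  · intro z _ hz he
    have h1 := congrArg tilt (congrFun he k)
    rw [Function.update_self, tilt_swap hk] at h1
    have : tilt (z k) = 0 := by linarith
    simp [this] at hz
  · intro z hz
    simp only [mem_filter, mem_univ, true_and] at hz ⊢
    intro i hi
    rw [Function.update_of_ne (ne_of_mem_of_not_mem hi hU)]
    exact hz i hi
  · intro z _
    simp

/-- The stage statements hold under the perturbed uniform weights. -/
theorem IsCStree.condIndep_tiltedWeight {T : StagedTree d L} (hT : T.IsCStree)
    (hd : ∀ i, 2 ≤ d i) (k : Fin p) (v : Outcome d (Iio k)) (l : Fin p) (u : Outcome d (Iio l))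
    (C : Finset (Fin p)) (hC : C ⊆ Iio l)
    (h : ∀ i : Iio l, i.1 ∈ C ↔ ∀ w, T.SameStage l u l w → w i = u i) :
    CondIndep (T.tiltedWeight k v) {l} (Iio l \ C) ∅ C (u.sub hC) := by
  have hne := (extensionCount_pos hd (Iio l)).ne'
  rcases lt_trichotomy l k with hlk | rfl | hlk
  -- Before level `k` the tilt is summed out, and after it the tilt is already fixed by the
  -- preceding variables. In both cases `X_l` is conditionally uniform; only `l = k` sees the
  -- perturbation, which is constant on each stage.
  · refine CondIndep.of_chain_rule hd hC
      (fun _ => extensionCount d (Iic l) / extensionCount d (Iio l)) fun y _ => ?_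
    rw [marginal_tiltedWeight_of_notMem T hd v (by simpa using hlk),
      marginal_tiltedWeight_of_notMem T hd v (by simpa using hlk.le)]
    field_simp
  · classical
    refine CondIndep.of_chain_rule hd hC
      (fun s => extensionCount d (Iic l) / extensionCount d (Iio l) / 2 *
        (2 + (if T.SameStage l v l u then 1 else 0) * tilt s)) fun y hy => ?_
    rw [marginal_tiltedWeight_of_Iic_subset T v subset_rfl,
      marginal_tiltedWeight_of_notMem T hd v (by simp)]
    have hu : T.SameStage l u l fun i => y i :=
      hT.sameStage_of_agree h fun i hi => hy ⟨i.1, hi⟩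
    have hv : T.SameStage l v l (fun i => y i) ↔ T.SameStage l v l u :=
      ⟨fun h => h.trans hu.symm, fun h => h.trans hu⟩
    unfold tiltedWeight
    simp only [hv]
    field_simp
  · refine CondIndep.of_chain_rule hd hC
      (fun _ => extensionCount d (Iic l) / extensionCount d (Iio l)) fun y _ => ?_
    rw [marginal_tiltedWeight_of_Iic_subset T v
        fun i hi => mem_Iic.2 ((mem_Iic.1 hi).trans hlk.le),
      marginal_tiltedWeight_of_Iic_subset T v
        fun i hi => mem_Iio.2 ((mem_Iic.1 hi).trans_lt hlk)]
    field_simp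

/-- If `J(T)` contains `X_k ⊥ X_{[k-1] ∖ S} | X_S`, then the stage of a node before `X_k` is
determined by the outcomes of the variables in `S`. -/
theorem IsCStree.sameStage_of_implied {T : StagedTree d L} (hT : T.IsCStree)
    (hd : ∀ i, 2 ≤ d i) {k : Fin p} {B S : Finset (Fin p)} (hBS : B ∪ S = Iio k)
    {x : Outcome d ∅} (h : T.Implied {k} B S ∅ x) {v w : Outcome d (Iio k)}
    (hvw : ∀ i : Iio k, i.1 ∈ S → v i = w i) : T.SameStage k v k w := by
  by_contra hne
  have hcond := h.condIndep hd (T.tiltedWeight_pos k v) (hT.condIndep_tiltedWeight hd k v)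
  -- Padding with outcome 0 gives `X_k` the value at which the tilt is 1.
  let ext (u : Outcome d (Iio k)) : (i : Fin p) → Fin (d i) := fun i =>
    if hi : i ∈ Iio k then u ⟨i, hi⟩ else ⟨0, lt_of_lt_of_le two_pos (hd i)⟩
  have hres : ∀ u, (fun i : Iio k => ext u i) = u := fun u => funext fun i => by
    simp only [ext, dif_pos i.2]
  have hk : ∀ u, tilt (ext u k) = 1 := fun u => by simp [ext, tilt]
  have hagree : ∀ i ∈ S, ext v i = ext w i := fun i hi => by
    have hi' : i ∈ Iio k := hBS ▸ mem_union_right _ hi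
    simp only [ext, dif_pos hi']
    exact hvw ⟨i, hi'⟩ hi
  have f1 := hcond.factor (ext v) (fun i => absurd i.2 (notMem_empty _))
  have f2 := hcond.factor (ext w) (fun i => absurd i.2 (notMem_empty _))
  have e : {k} ∪ B ∪ S = Iic k := by rw [union_assoc, hBS, ← insert_eq, Finset.Iio_insert]
  have hkS : k ∉ S := fun hk => lt_irrefl k (mem_Iio.1 (hBS ▸ mem_union_right _ hk))
  rw [union_empty, e, hBS, marginal_tiltedWeight_of_Iic_subset T v subset_rfl,
    marginal_tiltedWeight_of_notMem T hd v hkS,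
    marginal_tiltedWeight_of_notMem T hd v (by simp : k ∉ Iio k)] at f1 f2
  -- The marginals on `S` and on `Iio k` are constant, and the one on `{k} ∪ S` is the same for `v`
  -- and `w`. The factorizations thus force equal weights on `Iic k`, contradicting the values 3 in
  -- the stage of `v` and 2 outside it.
  have hm : marginal (T.tiltedWeight k v) ({k} ∪ S) (ext v) =
      marginal (T.tiltedWeight k v) ({k} ∪ S) (ext w) := by
    refine marginal_congr _ fun i hi => ?_
    rcases mem_union.1 hi with hi | hi
    · obtain rfl := mem_singleton.1 hi
      simp [ext]
    · exact hagree i hi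
  rw [hm, ← f2] at f1
  have h1 : T.tiltedWeight k v (ext v) = 3 := by
    unfold tiltedWeight
    rw [hres, hk, if_pos (show T.SameStage k v k v from rfl)]
    norm_num
  have h2 : T.tiltedWeight k v (ext w) = 2 := by
    unfold tiltedWeight
    rw [hres, hk, if_neg hne]
    norm_num
  rw [h1, h2] at f1
  have p1 := extensionCount_pos hd (Iic k)
  have p2 := extensionCount_pos hd S
  nlinarith [mul_pos p1 p2]

end StagedTree

/-! ### d-separation and the collider on three vertices -/

namespace OrderedDAG

variable {p : ℕ} {V : Finset (Fin p)} {G : OrderedDAG V} {A B S : Finset (Fin p)}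

theorem DSep.symm (h : G.DSep A B S) : G.DSep B A S := by
  intro b hb a ha l hl hl' ht
  refine h a ha b hb l.reverse (by simpa using hl') (by simpa using hl) ?_
  have rev : ∀ {m : List (Fin p)}, m <:+: l.reverse → m.reverse <:+: l := fun {m} hm => by
    simpa using List.reverse_infix.2 hm
  refine ⟨List.nodup_reverse.2 ht.nodup, fun u v huv => (ht.adjacent v u (rev huv)).symm,
    fun u v w huv h1 h2 => ht.collider w v u (rev huv) h2 h1,
    fun u v w huv h1 => ht.noncollider w v u (rev huv) fun h2 => h1 h2.symm⟩

/-- Adjacent vertices are never d-separated. -/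
theorem DSep.not_edge (h : G.DSep A B S) {u v : Fin p} (hu : u ∈ A) (hv : v ∈ B) :
    ¬ G.Edge u v := by
  intro huv
  refine h u hu v hv [u, v] rfl rfl ⟨by simpa using (G.lt huv).ne, fun a b hab => ?_,
    fun a b c habc => ?_, fun a b c habc => ?_⟩
  · have := hab.eq_of_length rfl
    simp only [List.cons.injEq, and_true] at this
    rw [this.1, this.2]
    exact Or.inl huv
  · exact absurd habc.length_le (by simp)
  · exact absurd habc.length_le (by simp)

/-- A vertex with no incident edges is d-separated from all others. -/
theorem dSep_of_isolated {a b : Fin p} (hab : a ≠ b) (h : ∀ v, ¬ G.Edge a v ∧ ¬ G.Edge v a) :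
    G.DSep {a} {b} S := by
  intro a' ha' b' hb' l hl hl' ht
  obtain rfl := mem_singleton.1 ha'
  obtain rfl := mem_singleton.1 hb'
  match l, hl, hl' with
  | [c], hl, hl' =>
    simp only [List.head?_cons, List.getLast?_singleton, Option.some.injEq] at hl hl'
    exact hab (hl.symm.trans hl')
  | c :: v :: l, hl, _ =>
    simp only [List.head?_cons, Option.some.injEq] at hl
    subst hl
    exact (ht.adjacent c v ⟨[], l, rfl⟩).elim (h v).1 (h v).2

section Collider

variable {V : Finset (Fin 3)} {G : OrderedDAG V} {A B S : Finset (Fin 3)}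
  {J : Finset (Fin 3) → Finset (Fin 3) → Finset (Fin 3) → Prop}

/-- The graph with vertices `0, 1, 2` and edges `0 → 2`, `1 → 2`. -/
def collider : OrderedDAG (∅ᶜ : Finset (Fin 3)) where
  Edge i j := i ≠ 2 ∧ j = 2
  left_mem _ := by simp
  right_mem _ := by simp
  lt := by
    rintro i j ⟨hi, rfl⟩
    omega

/-- On three vertices, the only DAG (in the given order) that is not perfect is a collider. -/
theorem edge_iff_of_not_isPerfect (h : ¬ G.IsPerfect) (i j : Fin 3) :
    G.Edge i j ↔ i ≠ 2 ∧ j = 2 := by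
  unfold IsPerfect at h
  push Not at h
  obtain ⟨a, b, c, hac, hbc, hab, h1, h2⟩ := h
  have lac := G.lt hac
  have lbc := G.lt hbc
  have hc : c = 2 := by omega
  subst hc
  constructor
  · intro hij
    have hlt := G.lt hij
    refine ⟨by omega, ?_⟩
    by_contra hj
    have hi : i = 0 := by omega
    have hj : j = 1 := by omega
    subst hi hj
    have : (a = 0 ∧ b = 1) ∨ (a = 1 ∧ b = 0) := by omega
    rcases this with ⟨rfl, rfl⟩ | ⟨rfl, rfl⟩
    · exact h1 hij
    · exact h2 hij
  · rintro ⟨hi, rfl⟩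
    have : i = a ∨ i = b := by omega
    rcases this with rfl | rfl
    · exact hac
    · exact hbc

/-- A trail from 1 to 0 must pass through 2 and leave to another source. There 2 is a collider,
blocked because the conditioning set is empty. -/
theorem dSep_of_collider (h : ∀ i j, G.Edge i j ↔ i ≠ 2 ∧ j = 2) : G.DSep {1} {0} ∅ := by
  intro a' ha' b' hb' l hl hl' ht
  obtain rfl := mem_singleton.1 ha'
  obtain rfl := mem_singleton.1 hb'
  match l, hl, hl' with
  | [c], hl, hl' =>
    simp only [List.head?_cons, List.getLast?_singleton, Option.some.injEq] at hl hl'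
    exact absurd (hl.symm.trans hl') (by decide)
  | [c, v], hl, hl' =>
    simp only [List.head?_cons, Option.some.injEq, List.getLast?_cons_cons,
      List.getLast?_singleton] at hl hl'
    subst hl hl'
    rcases ht.adjacent 1 0 ⟨[], [], rfl⟩ with h' | h'
    · exact absurd ((h _ _).1 h').2 (by decide)
    · exact absurd ((h _ _).1 h').2 (by decide)
  | c :: v :: w :: l, hl, _ =>
    simp only [List.head?_cons, Option.some.injEq] at hl
    subst hl
    have hv : v = 2 := by
      rcases ht.adjacent 1 v ⟨[], w :: l, rfl⟩ with h' | h'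
      · exact ((h _ _).1 h').2
      · exact absurd ((h _ _).1 h').2 (by decide)
    subst hv
    have hw : w ≠ 2 := by
      rintro rfl
      simpa using ht.nodup
    obtain ⟨s, hs, -⟩ := ht.collider 1 2 w ⟨[], l, rfl⟩ ((h _ _).2 ⟨by decide, rfl⟩)
      ((h _ _).2 ⟨hw, rfl⟩)
    exact absurd hs (by simp)

/-- Given their common child, the two sources of the collider are not d-separated. -/
theorem DSep.notMem_of_collider (hD : collider.DSep A B S) {a b : Fin 3} (ha : a ∈ A)
    (hb : b ∈ B) (hab : a ≠ b) : a ≠ 2 ∧ b ≠ 2 ∧ 2 ∉ S := by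
  have ha2 : a ≠ 2 := by
    rintro rfl
    exact hD.symm.not_edge hb ha ⟨hab.symm, rfl⟩
  have hb2 : b ≠ 2 := by
    rintro rfl
    exact hD.not_edge ha hb ⟨hab, rfl⟩
  refine ⟨ha2, hb2, fun hS => hD a ha b hb [a, 2, b] rfl rfl
    ⟨by simp [ha2, hb2.symm, hab], fun u v huv => ?_, fun u v w huvw h1 h2 => ?_,
      fun u v w huvw h => ?_⟩⟩
  · have : (u = a ∧ v = 2) ∨ (u = 2 ∧ v = b) := by
      rcases List.infix_cons_iff.1 huv with h | h
      · obtain ⟨t, ht⟩ := h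
        simp at ht
        exact Or.inl ⟨ht.1, ht.2.1⟩
      · have := h.eq_of_length rfl
        simp at this
        exact Or.inr this
    rcases this with ⟨rfl, rfl⟩ | ⟨rfl, rfl⟩
    · exact Or.inl ⟨ha2, rfl⟩
    · exact Or.inr ⟨hb2, rfl⟩
  · have := huvw.eq_of_length rfl
    simp only [List.cons.injEq, and_true] at this
    exact ⟨2, hS, this.2.1 ▸ Relation.ReflTransGen.refl⟩
  · have := huvw.eq_of_length rfl
    simp only [List.cons.injEq, and_true] at this
    obtain ⟨rfl, rfl, rfl⟩ := this
    exact absurd ⟨⟨ha2, rfl⟩, ⟨hb2, rfl⟩⟩ h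

/-- Vertex 2 is adjacent to both others and opens the trail between them when conditioned on, so the
two hypotheses are the only d-separations to check. -/
theorem isIMAP_collider (h : J {0} {1} ∅) (h' : J {1} {0} ∅) : collider.IsIMAP J := by
  intro A B S _ _ _ hA hB hAB hAS hBS hD
  have key : ∀ a ∈ A, ∀ b ∈ B, a ≠ b ∧ a ≠ 2 ∧ b ≠ 2 ∧ 2 ∉ S := fun a ha b hb =>
    have hab : a ≠ b := fun e => Finset.disjoint_left.1 hAB ha (e ▸ hb)
    ⟨hab, hD.notMem_of_collider ha hb hab⟩
  obtain ⟨a, ha⟩ := hA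
  obtain ⟨b, hb⟩ := hB
  have hab := key a ha b hb
  have hA : A = {a} := eq_singleton_iff_unique_mem.2 ⟨ha, fun a' ha' => by
    have := key a' ha' b hb
    omega⟩
  have hB : B = {b} := eq_singleton_iff_unique_mem.2 ⟨hb, fun b' hb' => by
    have := key a ha b' hb'
    omega⟩
  have hS : S = ∅ := eq_empty_of_forall_notMem fun s hs => by
    have h1 : s ≠ a := fun e => Finset.disjoint_left.1 hAS ha (e ▸ hs)
    have h2 : s ≠ b := fun e => Finset.disjoint_left.1 hBS hb (e ▸ hs)
    have h3 : s ≠ 2 := fun e => hab.2.2.2 (e ▸ hs)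
    omega
  subst hA hB hS
  have : (a = 0 ∧ b = 1) ∨ (a = 1 ∧ b = 0) := by omega
  rcases this with ⟨rfl, rfl⟩ | ⟨rfl, rfl⟩
  · exact h
  · exact h'

/-- A graph on three vertices in which `b` and `c` are adjacent is an I-MAP if `X_a` is
independent of the other two variables. -/
theorem isIMAP_of_edge {a b c : Fin 3} (hab : a ≠ b) (hac : a ≠ c) (hbc : G.Edge b c)
    (h : ∀ B S : Finset (Fin 3), Disjoint B S → a ∉ B → a ∉ S → J {a} B S ∧ J B {a} S) :
    G.IsIMAP J := by
  have lbc := (G.lt hbc).ne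
  -- Since `b` and `c` are adjacent, they cannot lie on opposite sides, so every separation has
  -- `{a}` as one of its sides.
  have key : ∀ A B S : Finset (Fin 3), B.Nonempty → Disjoint A B → G.DSep A B S → a ∈ A →
      A = {a} := by
    intro A B S hB hAB hD ha
    obtain ⟨e, he⟩ := hB
    refine eq_singleton_iff_unique_mem.2 ⟨ha, fun a' ha' => by_contra fun hne => ?_⟩
    have h1 : e ≠ a := fun h => Finset.disjoint_left.1 hAB ha (h ▸ he)
    have h2 : e ≠ a' := fun h => Finset.disjoint_left.1 hAB ha' (h ▸ he)
    have : (a' = b ∧ e = c) ∨ (a' = c ∧ e = b) := by omega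
    rcases this with ⟨rfl, rfl⟩ | ⟨rfl, rfl⟩
    · exact hD.not_edge ha' he hbc
    · exact hD.symm.not_edge he ha' hbc
  intro A B S _ _ _ hA hB hAB hAS hBS hD
  by_cases ha : a ∈ A
  · obtain rfl := key A B S hB hAB hD ha
    exact (h B S hBS (by simpa using hAB) (by simpa using hAS)).1
  by_cases ha' : a ∈ B
  · obtain rfl := key B A S hA hAB.symm hD.symm ha'
    exact (h A S hAS (by simpa using hAB) (by simpa using hBS)).2
  exfalso
  obtain ⟨u, hu⟩ := hA
  obtain ⟨w, hw⟩ := hB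
  have h1 : u ≠ w := fun h => Finset.disjoint_left.1 hAB hu (h ▸ hw)
  have h2 : u ≠ a := fun h => ha (h ▸ hu)
  have h3 : w ≠ a := fun h => ha' (h ▸ hw)
  have : (u = b ∧ w = c) ∨ (u = c ∧ w = b) := by omega
  rcases this with ⟨rfl, rfl⟩ | ⟨rfl, rfl⟩
  · exact hD.not_edge hu hw hbc
  · exact hD.symm.not_edge hw hu hbc

end Collider

end OrderedDAG

/-! ### Derivations in `J(T)` and interpolating polynomials -/

namespace StagedTree

variable {p : ℕ} {d : Fin p → ℕ} {L : Type*}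

theorem Implied.congr {T : StagedTree d L} {A A' B B' S S' C C' : Finset (Fin p)}
    {x : Outcome d C} {x' : Outcome d C'} (h : T.Implied A B S C x) (hA : A = A') (hB : B = B')
    (hS : S = S') (hC : C = C') (hx : ∀ (i : Fin p) (hi : i ∈ C) (hi' : i ∈ C'),
      x ⟨i, hi⟩ = x' ⟨i, hi'⟩) : T.Implied A' B' S' C' x' := by
  subst hA hB hS hC
  have : x = x' := funext fun i => hx i.1 i.2 i.2
  exact this ▸ h

theorem Implied.mono {T : StagedTree d L} {A B D S C : Finset (Fin p)} {x : Outcome d C}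
    (h : T.Implied A D ∅ C x) (hBS : Disjoint B S) (hD : B ∪ S ⊆ D) : T.Implied A B S C x := by
  have h1 : T.Implied A (B ∪ S) ∅ C x :=
    Implied.decomposition (D := D) (by rwa [union_eq_right.2 hD])
  simpa using h1.weak_union hBS

/-- The stage of a node before `X_k` is determined by the outcomes of the variables in `S`. -/
def StageDeterminedBy (T : StagedTree d L) (k : Fin p) (S : Finset (Fin p)) : Prop :=
  ∀ v w : Outcome d (Iio k), (∀ i : Iio k, i.1 ∈ S → v i = w i) → T.SameStage k v k w

/-- If the stages before `X_k` are determined by `X_S`, then `J(T)` contains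
`X_k ⊥ X_{[k-1] ∖ S} | X_S`. -/
theorem StageDeterminedBy.implied {T : StagedTree d L} (hd : ∀ i, 2 ≤ d i) {k : Fin p}
    {S : Finset (Fin p)} (hS : S ⊆ Iio k) (h : T.StageDeterminedBy k S) (x : Outcome d ∅) :
    T.Implied {k} (Iio k \ S) S ∅ x := by
  classical
  -- Each value of `X_S` is treated as a context first; absorption over all these values then turns
  -- the context into conditioning.
  have key : ∀ y : Outcome d S, T.Implied {k} (Iio k \ S) ∅ S y := by
    intro y
    let v : Outcome d (Iio k) := fun i =>
      if hi : i.1 ∈ S then y ⟨i.1, hi⟩ else ⟨0, lt_of_lt_of_le two_pos (hd i)⟩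
    let C : Finset (Fin p) :=
      {l | ∃ hl : l ∈ Iio k, ∀ w, T.SameStage k v k w → w ⟨l, hl⟩ = v ⟨l, hl⟩}
    have hC : C ⊆ Iio k := fun l hl => (mem_filter.1 hl).2.1
    have hCS : C ⊆ S := by
      intro l hl
      obtain ⟨hlk, hl⟩ := (mem_filter.1 hl).2
      by_contra hlS
      -- Outside `S` the node `v` has the default outcome 0. Changing one such coordinate to 1 stays
      -- in the stage, so the stage does not fix that coordinate.
      let w : Outcome d (Iio k) := Function.update v ⟨l, hlk⟩ ⟨1, lt_of_lt_of_le one_lt_two (hd l)⟩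
      have hw : T.SameStage k v k w := by
        refine h v w fun i hi => (Function.update_of_ne (fun e => hlS ?_) _ _).symm
        subst e
        exact hi
      have := hl w hw
      simp [w, v, hlS] at this
    have h1 : T.Implied {k} (Iio k \ C) ∅ C (v.sub hC) :=
      Implied.stage k v C hC fun l => by
        simp only [C, mem_filter, mem_univ, true_and]
        exact ⟨fun ⟨_, h⟩ => h, fun h => ⟨l.2, h⟩⟩
    have h2 : T.Implied {k} (Iio k \ S) (S \ C) C (v.sub hC) := by
      refine h1.mono (disjoint_sdiff_self_left.mono_right sdiff_subset) ?_
      exact union_subset (sdiff_subset_sdiff subset_rfl hCS) (sdiff_subset_sdiff hS subset_rfl)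
    have hsub : S \ C ∪ C ⊆ Iio k := by rwa [sdiff_union_of_subset hCS]
    have h3 : T.Implied {k} (Iio k \ S) ((S \ C) \ (S \ C)) (S \ C ∪ C) (v.sub hsub) :=
      Implied.specialization subset_rfl _ h2
    refine h3.congr rfl rfl (Finset.sdiff_self _) (sdiff_union_of_subset hCS) fun i _ hi => ?_
    simp [Outcome.sub, v, hi]
  have y₀ : Outcome d S := fun i => ⟨0, lt_of_lt_of_le two_pos (hd i)⟩
  refine (Implied.absorption subset_rfl y₀ (key y₀) fun y _ => key y).congr rfl rfl
    (empty_union _) (Finset.sdiff_self _) fun i _ hi => ?_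
  exact absurd hi (notMem_empty i)

/-- The interpolating polynomial of a node at the second to last level. -/
theorem interp_of_eq_Iio (T : StagedTree d L) {k : Fin p} (hk : ∀ i, i ≤ k)
    {A : Finset (Fin p)} (hA : A = Iio k) (u : Outcome d A) :
    T.interp u = ∑ s, MvPolynomial.X (T.label k (fun i => u ⟨i.1, hA ▸ i.2⟩) s) := by
  subst hA
  unfold interp
  have hc : (Iio k)ᶜ = {k} := by
    ext i
    simpa using ⟨fun h => le_antisymm (hk i) h, fun h => h.ge⟩
  rw [hc]
  simp only [prod_singleton]
  refine Finset.sum_bij (fun x _ => x k) (fun _ _ => mem_univ _) ?_ ?_ ?_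
  · intro x hx y hy hxy
    simp only [mem_filter, mem_univ, true_and] at hx hy
    funext i
    rcases (hk i).lt_or_eq with hi | rfl
    · exact (hx ⟨i, mem_Iio.2 hi⟩).trans (hy ⟨i, mem_Iio.2 hi⟩).symm
    · exact hxy
  · intro s _
    refine ⟨fun i => if h : i ∈ Iio k then u ⟨i, h⟩
      else (le_antisymm (hk i) (not_lt.1 fun hi => h (mem_Iio.2 hi))) ▸ s, ?_, ?_⟩
    · simp only [mem_filter, mem_univ, true_and]
      intro i
      rw [dif_pos i.2]
    · exact dif_neg (by simp)
  · intro x hx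
    simp only [mem_filter, mem_univ, true_and] at hx
    have : (fun i : Iio k => x i) = u := funext hx
    rw [this]

/-- The interpolating polynomial of a leaf is `1`. -/
theorem interp_of_eq_univ (T : StagedTree d L) {A : Finset (Fin p)} (hA : A = univ)
    (u : Outcome d A) : T.interp u = 1 := by
  subst hA
  unfold interp
  have : ({x : (i : Fin p) → Fin (d i) | ∀ i : (univ : Finset (Fin p)), x i = u i} : Finset _) =
      {fun i => u ⟨i, mem_univ i⟩} := by
    ext x
    simp only [mem_filter, mem_univ, true_and, mem_singleton]
    exact ⟨fun h => funext fun i => h ⟨i, mem_univ i⟩, fun h i => by rw [h]⟩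
  rw [this, sum_singleton]
  simp

/-- If the product of two label sums vanishes where the labels at the node `u` are set to zero,
then one of the nodes is in the stage of `u`. -/
theorem sameStage_or_of_mul_eq (T : StagedTree d L) {k : Fin p} (hk : 0 < d k)
    {u u' w w' : Outcome d (Iio k)}
    (h : (∑ s, MvPolynomial.X (T.label k u s) : MvPolynomial L ℝ) *
        ∑ s, MvPolynomial.X (T.label k w s) =
      (∑ s, MvPolynomial.X (T.label k u' s)) * ∑ s, MvPolynomial.X (T.label k w' s)) :
    T.SameStage k u k u' ∨ T.SameStage k u k w' := by
  classical
  -- A node in another stage has labels disjoint from those at `u`, so its label sum evaluates to `d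
  -- k`, which is nonzero.
  let φ : L → ℝ := fun l => if l ∈ Set.range (T.label k u) then 0 else 1
  have h0 : MvPolynomial.eval φ (∑ s, MvPolynomial.X (T.label k u s)) = 0 := by
    simp [map_sum, φ]
  have h1 : ∀ z, ¬ T.SameStage k u k z →
      MvPolynomial.eval φ (∑ s, MvPolynomial.X (T.label k z s)) ≠ 0 := by
    intro z hz
    have hdisj := (T.eq_or_disjoint k u k z).resolve_left hz
    have hval : ∀ s, φ (T.label k z s) = 1 := fun s =>
      if_neg fun hs => Set.disjoint_left.1 hdisj hs ⟨s, rfl⟩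
    simp only [map_sum, MvPolynomial.eval_X, hval]
    simpa using hk.ne'
  by_contra! hne
  have he := congrArg (MvPolynomial.eval φ) h
  rw [map_mul, map_mul, h0, zero_mul] at he
  exact mul_ne_zero (h1 _ hne.1) (h1 _ hne.2) he.symm

/-! ### The stage criterion for three variables -/

section ThreeVariables

variable {d : Fin 3 → ℕ}

theorem Iio_two_eq_Iic_one : Iio (2 : Fin 3) = Iic 1 := by decide

/-- The node `v s` at level two. -/
def grandchild (v : Outcome d (Iio 1)) (s : Fin (d 1)) : Outcome d (Iio 2) :=
  fun i => v.child s ⟨i.1, Iio_two_eq_Iic_one ▸ i.2⟩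

theorem grandchild_of_ne_one (v : Outcome d (Iio 1)) (s r : Fin (d 1)) {i : Iio (2 : Fin 3)}
    (hi : i.1 ≠ 1) : grandchild v s i = grandchild v r i := by
  simp [grandchild, Outcome.child, hi]

theorem grandchild_one (v w : Outcome d (Iio 1)) (s : Fin (d 1)) {i : Iio (2 : Fin 3)}
    (hi : i.1 = 1) : grandchild v s i = grandchild w s i := by
  simp [grandchild, Outcome.child, hi]

theorem grandchild_eq_self (u : Outcome d (Iio 2)) :
    grandchild (u.sub (by decide)) (u ⟨1, by decide⟩) = u := by
  funext i
  obtain ⟨i, hi⟩ := i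
  unfold grandchild Outcome.child Outcome.sub
  by_cases h : i = 1
  · subst h
    simp
  · simp [h]

theorem interp_child_one (T : StagedTree d L) (v : Outcome d (Iio 1)) (s : Fin (d 1)) :
    T.interp (v.child s) = ∑ r, MvPolynomial.X (T.label 2 (grandchild v s) r) :=
  T.interp_of_eq_Iio (k := 2) (fun i => Fin.le_last i) Iio_two_eq_Iic_one.symm _

theorem interp_child_congr {T : StagedTree d L} (hT : T.IsCStree) {v w : Outcome d (Iio 1)}
    {s r : Fin (d 1)} (h : T.SameStage 2 (grandchild v s) 2 (grandchild w r)) :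
    T.interp (v.child s) = T.interp (w.child r) := by
  rw [interp_child_one, interp_child_one]
  exact Finset.sum_congr rfl fun z _ => by rw [hT.compatible 2 _ _ h z]

/-- The nodes before `X_2` form a table with rows `v` and columns `s`; dependence on `X_0` alone
means that the stage is constant along rows, and the next lemma does the same for columns. -/
theorem stageDeterminedBy_zero_iff (T : StagedTree d L) :
    T.StageDeterminedBy 2 {0} ↔
      ∀ v s r, T.SameStage 2 (grandchild v s) 2 (grandchild v r) := by
  refine ⟨fun h v s r => h _ _ fun i hi => grandchild_of_ne_one v s r ?_, fun h v w hvw => ?_⟩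
  · rw [mem_singleton.1 hi]
    decide
  · rw [← grandchild_eq_self v, ← grandchild_eq_self w]
    have hsub : Iio (1 : Fin 3) ⊆ Iio 2 := by decide
    have : v.sub hsub = w.sub hsub := funext fun i => by
      refine hvw ⟨i.1, _⟩ (mem_singleton.2 ?_)
      have := mem_Iio.1 i.2
      change i.1 = 0
      omega
    rw [this]
    exact h _ _ _

theorem stageDeterminedBy_one_iff (T : StagedTree d L) :
    T.StageDeterminedBy 2 {1} ↔
      ∀ v w s, T.SameStage 2 (grandchild v s) 2 (grandchild w s) := by
  refine ⟨fun h v w s => h _ _ fun i hi => grandchild_one v w s (mem_singleton.1 hi),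
    fun h v w hvw => ?_⟩
  rw [← grandchild_eq_self v, ← grandchild_eq_self w, hvw ⟨1, by decide⟩ (by simp)]
  exact h _ _ _

/-- Before the second variable, either all nodes are in one stage or all are in different
stages. -/
theorem IsCStree.stageDeterminedBy_empty {T : StagedTree d L} (hT : T.IsCStree)
    {v w : Outcome d (Iio 1)} (h : T.SameStage 1 v 1 w) (hvw : v ≠ w) :
    T.StageDeterminedBy 1 ∅ := by
  obtain ⟨C, hC, x, hx⟩ := hT.context 1 v
  have hC0 : C = ∅ := by
    refine eq_empty_of_forall_notMem fun i hi => hvw (funext fun j => ?_)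
    have e := ((hx v).1 rfl).trans ((hx w).1 h).symm
    have hij : i = j.1 := by
      have h1 := mem_Iio.1 (hC hi)
      have h2 := mem_Iio.1 j.2
      omega
    subst hij
    exact congrFun e ⟨j.1, hi⟩
  subst hC0
  have key : ∀ u, T.SameStage 1 v 1 u := fun u =>
    (hx u).2 (funext fun i => absurd i.2 (notMem_empty _))
  exact fun u u' _ => (key u).symm.trans (key u')

/-- A CStree on three variables is balanced if and only if `X_0` and `X_1` are dependent, or the
stages before `X_2` are determined by one of them. -/
theorem IsCStree.isBalanced_iff {T : StagedTree d L} (hT : T.IsCStree) (hd : ∀ i, 2 ≤ d i) :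
    T.IsBalanced ↔ (T.StageDeterminedBy 1 ∅ →
      T.StageDeterminedBy 2 {0} ∨ T.StageDeterminedBy 2 {1}) := by
  constructor
  · intro hB h1
    have key : ∀ v w s r, T.SameStage 2 (grandchild v s) 2 (grandchild v r) ∨
        T.SameStage 2 (grandchild v s) 2 (grandchild w s) := by
      intro v w s r
      have := hB 1 v w (h1 v w fun i hi => absurd hi (notMem_empty _)) s r
      simp only [interp_child_one] at this
      exact T.sameStage_or_of_mul_eq (lt_of_lt_of_le two_pos (hd 2)) this
    rw [stageDeterminedBy_zero_iff, stageDeterminedBy_one_iff]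
    -- Take a row `a` with different stages in columns `s`, `r`, and a column `t` with different
    -- stages in rows `b`, `c`. Then `key` links `(a,s)`, `(b,s)`, `(b,t)`, `(b,r)`, `(a,r)` into
    -- one stage.
    by_contra! hne
    obtain ⟨⟨a, s, r, hasr⟩, ⟨b, c, t, hbct⟩⟩ := hne
    have e1 := (key a b s r).resolve_left hasr
    have e2 := (key a b r s).resolve_left fun h => hasr h.symm
    have e3 := (key b c t s).resolve_right hbct
    have e4 := (key b c t r).resolve_right hbct
    exact hasr (e1.trans (e3.symm.trans (e4.trans e2.symm)))
  · intro h k v w hvw s r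
    by_cases he : v = w
    · rw [he, mul_comm]
    -- Level 0 has only the root, and at level 2 the children are leaves with polynomial 1. At level
    -- 1, constant rows or columns make the two products agree factor by factor.
    match k, v, w, hvw, s, r, he with
    | 0, v, w, hvw, s, r, he =>
      exact absurd (funext fun i => absurd (mem_Iio.1 i.2) (Fin.not_lt_zero _)) he
    | 1, v, w, hvw, s, r, he =>
      rcases h (hT.stageDeterminedBy_empty hvw he) with h0 | h0
      · rw [stageDeterminedBy_zero_iff] at h0
        rw [interp_child_congr hT (h0 v s r), interp_child_congr hT (h0 w r s)]
      · rw [stageDeterminedBy_one_iff] at h0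
        rw [interp_child_congr hT (h0 v w s), interp_child_congr hT (h0 w v r), mul_comm]
    | 2, v, w, hvw, s, r, he =>
      simp only [T.interp_of_eq_univ (by decide : Iic (2 : Fin 3) = univ)]

open OrderedDAG in
/-- The minimal context DAGs are perfect if and only if `X_0` and `X_1` are dependent, or the
stages before `X_2` are determined by one of them. -/
theorem IsCStree.forall_isPerfect_iff {T : StagedTree d L} (hT : T.IsCStree)
    (hd : ∀ i, 2 ≤ d i) :
    (∀ (C : Finset (Fin 3)) (x : Outcome d C) (G : OrderedDAG Cᶜ),
        T.IsMinimalContextDAG C x G → G.IsPerfect) ↔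
      (T.StageDeterminedBy 1 ∅ → T.StageDeterminedBy 2 {0} ∨ T.StageDeterminedBy 2 {1}) := by
  constructor
  · intro h h1
    have x : Outcome d ∅ := fun i => absurd i.2 (notMem_empty _)
    have h10 : T.Implied {1} {0} ∅ ∅ x := (h1.implied hd (empty_subset _) x).congr rfl
      (by decide) rfl rfl fun _ _ _ => rfl
    -- If neither variable alone determines the stages, the collider itself is an imperfect minimal
    -- context DAG: deleting an edge isolates a source, and the resulting separation from 2 would
    -- make the other source determine the stages.
    by_contra hne
    refine absurd (h ∅ x collider ⟨⟨{1}, {0}, ∅, by simp, by simp, h10, fun T' hT' hn => ?_⟩,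
      isIMAP_collider h10.symmetry h10, fun a b hab hI => hne ?_⟩) ?_
    · exact absurd (subset_empty.1 hT') hn.ne_empty
    · obtain ⟨ha, rfl⟩ := hab
      have : a = 0 ∨ a = 1 := by omega
      rcases this with rfl | rfl
      · refine Or.inr fun v w hvw => ?_
        have hsep : (collider.removeEdge 0 2).DSep {0} {2} {1} :=
          dSep_of_isolated (by decide) fun v => ⟨fun hv => hv.2 ⟨rfl, hv.1.2⟩,
            fun hv => absurd hv.1.2 (by decide)⟩
        have hJ := hI {0} {2} {1} (by decide) (by decide) (by decide) (by simp) (by simp)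
          (by decide) (by decide) (by decide) hsep
        exact hT.sameStage_of_implied hd (by decide) hJ.symmetry hvw
      · refine Or.inl fun v w hvw => ?_
        have hsep : (collider.removeEdge 1 2).DSep {1} {2} {0} :=
          dSep_of_isolated (by decide) fun v => ⟨fun hv => hv.2 ⟨rfl, hv.1.2⟩,
            fun hv => absurd hv.1.2 (by decide)⟩
        have hJ := hI {1} {2} {0} (by decide) (by decide) (by decide) (by simp) (by simp)
          (by decide) (by decide) (by decide) hsep
        exact hT.sameStage_of_implied hd (by decide) hJ.symmetry hvw
    · intro hperf
      rcases hperf 0 1 2 ⟨by decide, rfl⟩ ⟨by decide, rfl⟩ (by decide) with h | h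
      · exact absurd h.2 (by decide)
      · exact absurd h.2 (by decide)
  · rintro h C x G ⟨-, hI, hmin⟩
    by_contra hperf
    have hG := edge_iff_of_not_isPerfect hperf
    have e02 : G.Edge 0 2 := (hG 0 2).2 ⟨by decide, rfl⟩
    have e12 : G.Edge 1 2 := (hG 1 2).2 ⟨by decide, rfl⟩
    have hC : C = ∅ := by
      refine eq_empty_of_forall_notMem fun i hi => ?_
      have m0 := mem_compl.1 (G.left_mem e02)
      have m1 := mem_compl.1 (G.left_mem e12)
      have m2 := mem_compl.1 (G.right_mem e12)
      have h0 := ne_of_mem_of_not_mem hi m0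
      have h1 := ne_of_mem_of_not_mem hi m1
      have h2 := ne_of_mem_of_not_mem hi m2
      omega
    subst hC
    have h10 : T.Implied {1} {0} ∅ ∅ x := hI {1} {0} ∅ (by decide) (by decide) (by decide)
      (by simp) (by simp) (by decide) (by decide) (by decide) (dSep_of_collider hG)
    have hsub : ∀ {a : Fin 3} {B S D : Finset (Fin 3)}, D = {a}ᶜ → a ∉ B → a ∉ S →
        B ∪ S ⊆ D := by
      rintro a B S _ rfl hB hS i hi
      rw [mem_compl, mem_singleton]
      rintro rfl
      exact (mem_union.1 hi).elim hB hS
    have h1 : T.StageDeterminedBy 1 ∅ := fun v w hvw =>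
      hT.sameStage_of_implied hd (by decide) h10 hvw
    rcases h h1 with h2 | h2
    · have h21 : T.Implied {2} {1} {0} ∅ x := (h2.implied hd (by decide) x).congr rfl
        (by decide) rfl rfl fun _ _ _ => rfl
      -- Contraction makes `X_1` independent of the pair `(X_0, X_2)`, so the collider remains an
      -- I-MAP without `1 → 2`, against minimality. The other case exchanges 0 and 1.
      have hfull : T.Implied {1} ({2} ∪ {0}) ∅ ∅ x :=
        Implied.contraction (by simpa using h21.symmetry) h10
      refine hmin 1 2 e12 (isIMAP_of_edge (a := 1) (b := 0) (c := 2) (by decide) (by decide)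
        ⟨e02, by decide⟩ fun B S hBS hB hS => ?_)
      have := hfull.mono hBS (hsub (by decide) hB hS)
      exact ⟨this, this.symmetry⟩
    · have h20 : T.Implied {2} {0} {1} ∅ x := (h2.implied hd (by decide) x).congr rfl
        (by decide) rfl rfl fun _ _ _ => rfl
      have hfull : T.Implied {0} ({2} ∪ {1}) ∅ ∅ x :=
        Implied.contraction (by simpa using h20.symmetry) h10.symmetry
      refine hmin 0 2 e02 (isIMAP_of_edge (a := 0) (b := 1) (c := 2) (by decide) (by decide)
        ⟨e12, by decide⟩ fun B S hBS hB hS => ?_)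
      have := hfull.mono hBS (hsub (by decide) hB hS)
      exact ⟨this, this.symmetry⟩

end ThreeVariables

end StagedTree

theorem mainTheorem5 {L : Type*} [Finite L] (d : Fin 3 → ℕ) (hd : ∀ i, 2 ≤ d i)
    (T : StagedTree d L) (hT : T.IsCStree) :
    T.IsBalanced ↔
      ∀ (C : Finset (Fin 3)) (x : Outcome d C) (G : OrderedDAG Cᶜ),
        T.IsMinimalContextDAG C x G → G.IsPerfect :=
  (hT.isBalanced_iff hd).trans (hT.forall_isPerfect_iff hd).symm
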